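/- **Setting.** Let $\mathcal Q\subset\mathbb R^2$ be convex and compact with non-empty interior, of area $\mathcal A$, and let $v_{\max},u_{\max},\rho,w_{\max}>0$. Service requests are generated at the times of a Poisson process on $[0,\infty)$ of rate $\lambda>0$, at locations that are independent of each other and of the times and uniformly distributed on $\mathcal Q$. They are served by $m$ identical robots, of one of two kinds. * *Double integrator (DI)*: position $p\in\mathbb R^2$ and velocity $v\in\mathbb R^2$ with $\dot p=v$, $\dot v=u$, $\|v\|\le v_{\max}$, $\|u\|\le u_{\max}$, where $u$ is the input. * *Differential drive (DD)*: position $(x,y)$ and heading $\theta$ with $\dot x=\tfrac12(w_l+w_r)\cos\theta$, $\dot y=\tfrac12(w_l+w_r)\sin\theta$, $\dot\theta=\tfrac1{2\rho}(w_r-w_l)$, $|w_l|,|w_r|\le w_{\max}$, where $(w_l,w_r)$ is the input. A motion coordination policy $\pi$ chooses the initial configurations of the robots and a measurable input for each of them; the inputs at time $t$ may depend on the requests generated up to time $t$ (times and locations) and on a random seed independent of the requests, but not on later requests, and the resulting configurations are random variables. A request is fulfilled as soon as, at or after its generation, some robot is at its location. Let $T_j\in[0,\infty]$ be the time between the generation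 and the fulfilment of the $j$-th request, and let $$T_\pi=\lim_{j\to\infty}\ \lim_{\lambda\to0^+}\mathrm E[T_j]$$ (lower limits, where the limits do not exist) be the system time of $\pi$. The optimal coverage cost is $T_{\mathrm{opt}}=\inf_\pi T_\pi$, the infimum being over all policies for the $m$ robots; it is written $T^{\mathrm{DI}}_{\mathrm{opt}}$ and $T^{\mathrm{DD}}_{\mathrm{opt}}$ for the two kinds of robots and depends on $m$. **Theorem (asymptotic lower bound on the coverage cost).** With $\mathcal Q$, $v_{\max},u_{\max},\rho,w_{\max}$ fixed, $$\liminf_{m\to\infty}T^{\mathrm{DI}}_{\mathrm{opt}}\,m^{1/3}\ \ge\ \frac1{24}\Big(\frac{\mathcal A}{2v_{\max}u_{\max}}\Big)^{1/3},\qquad \liminf_{m\to\infty}T^{\mathrm{DD}}_{\mathrm{opt}}\,m^{1/3}\ \ge\ \frac1{5w_{\max}}\Big(\frac{6\rho\mathcal A}{5}\Big)^{1/3}.$$ Hence $T^{\mathrm{DI}}_{\mathrm{opt}}$ and $T^{\mathrm{DD}}_{\mathrm{opt}}$ are both $\Omega(m^{-1/3})$: for each of them there is a constant $c>0$ with $T_{\mathrm{opt}}\ge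 c\,m^{-1/3}$ for all sufficiently large $m$. -/

import Mathlib

open MeasureTheory ProbabilityTheory Filter Topology
open scoped ENNReal unitInterval

/-- The plane with its Euclidean norm; `volume` on it is area. -/
abbrev Plane := EuclideanSpace ℝ (Fin 2)

/-! ### Robots -/

/-- A robot: a controlled ordinary differential equation `ġ = vectorField g u` on a configuration
space `G`, with pointwise constraints on the input and on the configuration, and with the position
in the plane that belongs to a configuration. -/
structure RobotModel (G U : Type) where
  vectorField : G → U → G
  inputs : Set U
  configs : Set G
  position : G → Plane

/-- The double integrator. A configuration is (position, velocity), the input is the acceleration;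
the speed is at most `vmax` and the norm of the acceleration at most `umax`. -/
def doubleIntegrator (vmax umax : ℝ) : RobotModel (Plane × Plane) Plane where
  vectorField g u := (g.2, u)
  inputs := {u | ‖u‖ ≤ umax}
  configs := {g | ‖g.2‖ ≤ vmax}
  position g := g.1

/-- The differential drive robot with unit wheels at distance `ρ` from its centre. A configuration
is (position, heading), the heading being a real number that matters only modulo `2π`; the input is
the pair (left, right) of angular velocities of the wheels, each bounded by `wmax`. -/
noncomputable def differentialDrive (ρ wmax : ℝ) : RobotModel (Plane × ℝ) (ℝ × ℝ) where
  vectorField g w :=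
    (((1 / 2) * (w.1 + w.2)) • !₂[Real.cos g.2, Real.sin g.2], (1 / (2 * ρ)) * (w.2 - w.1))
  inputs := {w | |w.1| ≤ wmax ∧ |w.2| ≤ wmax}
  configs := Set.univ
  position g := g.1

/-- On the time axis `[0, ∞)`, the input `u` drives the robot along `g`: the input is measurable,
the constraints hold at all times, and the differential equation holds in its integrated form
(Carathéodory solutions). -/
def RobotModel.IsTrajectory {G U : Type} [NormedAddCommGroup G] [NormedSpace ℝ G]
    [MeasurableSpace U] (R : RobotModel G U) (u : ℝ → U) (g : ℝ → G) : Prop :=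
  Measurable u ∧ ∀ t : ℝ, 0 ≤ t →
    u t ∈ R.inputs ∧ g t ∈ R.configs ∧
    IntervalIntegrable (fun s => R.vectorField (g s) (u s)) volume 0 t ∧
    g t = g 0 + ∫ s in (0 : ℝ)..t, R.vectorField (g s) (u s)

/-! ### Service requests -/

/-- A realization of the stream of service requests: for each request, the time elapsed since the
preceding request (since time `0` for the first one), and its location. -/
abbrev RequestStream := ℕ → ℝ × Plane

/-- The time at which request `j` is generated (requests are numbered from `0`). -/
noncomputable def arrivalTime (r : RequestStream) (j : ℕ) : ℝ :=
  ∑ k ∈ Finset.range (j + 1), (r k).1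

/-- The successive requests come at positive distances in time (this holds almost surely). -/
def IsSimpleStream (r : RequestStream) : Prop := ∀ k, 0 < (r k).1

/-- The streams `r` and `r'` show the same requests up to and including time `t`. -/
def SameHistory (r r' : RequestStream) (t : ℝ) : Prop :=
  ∀ k, (arrivalTime r k ≤ t ∨ arrivalTime r' k ≤ t) →
    arrivalTime r k = arrivalTime r' k ∧ (r k).2 = (r' k).2

/-- The law of a spatio-temporal Poisson process with time intensity `lam` (for `0 < lam`) and
uniform spatial density on `Q`: the times between successive requests are exponential of rate
`lam`, the locations are uniform on `Q`, and all of these are independent. -/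
noncomputable def requestLaw (Q : Set Plane) (lam : ℝ) : Measure RequestStream :=
  Measure.infinitePi fun _ : ℕ => (expMeasure lam).prod (cond volume Q)

/-! ### Motion coordination policies and their cost -/

/-- A motion coordination policy for `m` robots of the model `R`. It gives each robot a steering
command at each time, and thereby a motion, possibly depending on a random seed that is independent
of the requests, and on the requests, but at each time only on those generated so far.
In particular the initial configurations are chosen by the policy. -/
structure Policy {G U : Type} [NormedAddCommGroup G] [NormedSpace ℝ G] [MeasurableSpace G]
    [MeasurableSpace U] (R : RobotModel G U) (m : ℕ) where
  /-- The steering commands. -/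
  command : I → RequestStream → Fin m → ℝ → U
  /-- The configurations of the robots under these commands. -/
  config : I → RequestStream → Fin m → ℝ → G
  isTrajectory : ∀ z r, IsSimpleStream r → ∀ i, R.IsTrajectory (command z r i) (config z r i)
  command_causal : ∀ z r r' t, IsSimpleStream r → IsSimpleStream r' → 0 ≤ t →
    SameHistory r r' t → ∀ i, command z r i t = command z r' i t
  config_causal : ∀ z r r' t, IsSimpleStream r → IsSimpleStream r' → 0 ≤ t →
    SameHistory r r' t → ∀ i, config z r i t = config z r' i t
  measurable_config : ∀ i t, 0 ≤ t →
    Measurable fun ω : I × RequestStream => config ω.1 ω.2 i t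

namespace Policy

variable {G U : Type} [NormedAddCommGroup G] [NormedSpace ℝ G] [MeasurableSpace G]
  [MeasurableSpace U] {R : RobotModel G U} {m : ℕ}

/-- The time `T_j` between the generation of request `j` and its fulfilment, that is, the first
presence of a robot at its location from then on (`∞` if there is none). -/
noncomputable def waitingTime (π : Policy R m) (j : ℕ) (z : I) (r : RequestStream) : ℝ≥0∞ :=
  ⨅ (s : ℝ) (_ : 0 ≤ s ∧ ∃ i, R.position (π.config z r i (arrivalTime r j + s)) = (r j).2),
    ENNReal.ofReal s

/-- The expectation `E[T_j]` at request intensity `lam`; the seed is uniform on `[0, 1]` and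
independent of the requests. -/
noncomputable def expectedWaitingTime (π : Policy R m) (Q : Set Plane) (lam : ℝ) (j : ℕ) : ℝ≥0∞ :=
  ∫⁻ ω, π.waitingTime j ω.1 ω.2 ∂((volume : Measure I).prod (requestLaw Q lam))

/-- The system time `T_π = lim_{j → ∞} lim_{lam → 0⁺} E[T_j]`. The lower limits give it a meaning
for every policy; where the limits exist it is their value, see `Policy.systemTime_eq`. -/
noncomputable def systemTime (π : Policy R m) (Q : Set Plane) : ℝ≥0∞ :=
  liminf (fun j : ℕ => liminf (fun lam : ℝ => π.expectedWaitingTime Q lam j) (𝓝[>] 0)) atTop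

theorem systemTime_eq (π : Policy R m) (Q : Set Plane) (f : ℕ → ℝ≥0∞) (T : ℝ≥0∞)
    (hf : ∀ j, Tendsto (fun lam : ℝ => π.expectedWaitingTime Q lam j) (𝓝[>] 0) (𝓝 (f j)))
    (hT : Tendsto f atTop (𝓝 T)) : π.systemTime Q = T := by
  unfold systemTime
  simp only [fun j => (hf j).liminf_eq]
  exact hT.liminf_eq

end Policy

/-- The optimal coverage cost `T_opt = inf_π T_π` of `m` robots of the model `R` in `Q`. -/
noncomputable def optimalCost {G U : Type} [NormedAddCommGroup G] [NormedSpace ℝ G]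
    [MeasurableSpace G] [MeasurableSpace U] (R : RobotModel G U) (Q : Set Plane) (m : ℕ) : ℝ≥0∞ :=
  ⨅ π : Policy R m, π.systemTime Q

/-! Inertia makes short-time reachable sets thin. From a given configuration a robot moves in time
`t` along a segment of length O(t), fixed by that configuration, up to a deviation O(t²): bounded
acceleration bends the drift of a double integrator, and bounded turning rate bends the path of a
differential drive. The reachable area is thus `α t³ + β t⁴` (`doubleIntegrator_reachBound`,
`differentialDrive_reachBound`).

By causality the configurations just before a request are independent of its location, which is
uniform on `Q`. So `m` robots can reach it within time `t` with probability at most `m (α t³ + β t⁴)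
/ A`, where `A` is the area of `Q` (`measure_caught_le`), and otherwise it waits about `t`
(`le_expectedWaitingTime`). For `t` of order `m^(-1/3)` this probability is close to 1/4, which
gives the bound. The estimate is uniform in the policy, the intensity and the request index, so the
limits in the system time play no role. -/

/-! ### The area that a robot reaches in a short time -/

/-- The union of `N` discs of radius `2 * δ`, centred at equally spaced points of the segment from
`p` to `p + d`. -/
def tubeCover (p d : Plane) (δ : ℝ) (N : ℕ) : Set Plane :=
  ⋃ k ∈ Finset.range N, Metric.closedBall (p + (((2 * k + 1 : ℝ) / (2 * N))) • d) (2 * δ)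

theorem exists_lt_abs_sub_le {N : ℕ} (hN : 0 < N) {x : ℝ} (hx0 : 0 ≤ x) (hx1 : x ≤ 1) :
    ∃ k < N, |x - (2 * k + 1 : ℝ) / (2 * N)| ≤ 1 / (2 * N) := by
  have hN' : (0 : ℝ) < N := by exact_mod_cast hN
  obtain ⟨k, hk, h1, h2⟩ : ∃ k < N, (k : ℝ) ≤ x * N ∧ x * N ≤ k + 1 := by
    -- At `x = 1` the floor of `x * N` is `N`, out of range; the last index serves instead.
    rcases hx1.eq_or_lt with rfl | hx1
    · refine ⟨N - 1, by omega, ?_, ?_⟩ <;> rw [Nat.cast_sub hN] <;> push_cast <;> linarith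
    · refine ⟨⌊x * N⌋₊, ?_, Nat.floor_le (by positivity), (Nat.lt_floor_add_one _).le⟩
      rw [Nat.floor_lt (by positivity)]
      nlinarith
  refine ⟨k, hk, ?_⟩
  have : x - (2 * k + 1 : ℝ) / (2 * N) = (2 * (x * N) - (2 * k + 1)) / (2 * N) := by
    field_simp
  rw [this, abs_div, abs_of_pos (by positivity : (0 : ℝ) < 2 * N)]
  gcongr
  rw [abs_le]
  constructor <;> linarith

/-- The nearest centre is within `L / (2 * N) ≤ δ` of the point `p + x • d`. Taking `N` from the
bound `L` instead of `‖d‖` makes it the same for all configurations, which keeps the cover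
measurable in the configuration. -/
theorem mem_tubeCover {p d q : Plane} {L δ x : ℝ} (hL : 0 < L) (hδ : 0 < δ) (hd : ‖d‖ ≤ L)
    (hx0 : 0 ≤ x) (hx1 : x ≤ 1) (hq : ‖q - (p + x • d)‖ ≤ δ) :
    q ∈ tubeCover p d δ ⌈L / (2 * δ)⌉₊ := by
  set N := ⌈L / (2 * δ)⌉₊ with hNdef
  have hN : 0 < N := Nat.ceil_pos.2 (by positivity)
  have hN' : (0 : ℝ) < N := by exact_mod_cast hN
  obtain ⟨k, hk, hkx⟩ := exists_lt_abs_sub_le hN hx0 hx1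
  simp only [tubeCover, Set.mem_iUnion, Finset.mem_range, exists_prop]
  refine ⟨k, hk, ?_⟩
  rw [mem_closedBall_iff_norm]
  have hLN : L ≤ 2 * δ * N := by
    have := Nat.le_ceil (L / (2 * δ))
    rw [div_le_iff₀ (by positivity)] at this
    linarith
  calc ‖q - (p + ((2 * k + 1 : ℝ) / (2 * N)) • d)‖
      = ‖(q - (p + x • d)) + (x - (2 * k + 1 : ℝ) / (2 * N)) • d‖ := by
        congr 1; module
    _ ≤ δ + 1 / (2 * N) * L := by
        refine (norm_add_le _ _).trans (add_le_add hq ?_)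
        rw [norm_smul, Real.norm_eq_abs]
        gcongr
    _ ≤ 2 * δ := by
        have : 1 / (2 * N) * L ≤ δ := by
          rw [one_div, inv_mul_le_iff₀ (by positivity)]
          linarith
        linarith

theorem volume_tubeCover_le (p d : Plane) {L δ : ℝ} (hL : 0 < L) (hδ : 0 < δ) :
    volume (tubeCover p d δ ⌈L / (2 * δ)⌉₊) ≤
      ENNReal.ofReal (2 * Real.pi * δ * L + 4 * Real.pi * δ ^ 2) := by
  have hN : (⌈L / (2 * δ)⌉₊ : ℝ) ≤ L / (2 * δ) + 1 := (Nat.ceil_lt_add_one (by positivity)).le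
  calc volume (tubeCover p d δ ⌈L / (2 * δ)⌉₊)
      ≤ ∑ _k ∈ Finset.range ⌈L / (2 * δ)⌉₊, ENNReal.ofReal ((2 * δ) ^ 2 * Real.pi) := by
        refine (measure_biUnion_finset_le _ _).trans (Finset.sum_le_sum fun k _ => ?_)
        rw [EuclideanSpace.volume_closedBall_fin_two,
          ENNReal.ofReal_mul (sq_nonneg _), ENNReal.ofReal_pow (by positivity)]
    _ = ENNReal.ofReal (⌈L / (2 * δ)⌉₊ * ((2 * δ) ^ 2 * Real.pi)) := by
        rw [Finset.sum_const, Finset.card_range, nsmul_eq_mul,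
          ENNReal.ofReal_mul (Nat.cast_nonneg _), ENNReal.ofReal_natCast]
    _ ≤ ENNReal.ofReal ((L / (2 * δ) + 1) * ((2 * δ) ^ 2 * Real.pi)) := by gcongr
    _ = _ := by congr 1; field_simp; ring

theorem measurableSet_prod_tubeCover {G : Type} [MeasurableSpace G] {p d : G → Plane}
    (hp : Measurable p) (hd : Measurable d) (δ : ℝ) (N : ℕ) :
    MeasurableSet {x : G × Plane | x.2 ∈ tubeCover (p x.1) (d x.1) δ N} := by
  have hp' : Measurable fun x : G × Plane => p x.1 := hp.comp measurable_fst
  have hd' : Measurable fun x : G × Plane => d x.1 := hd.comp measurable_fst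
  have h : {x : G × Plane | x.2 ∈ tubeCover (p x.1) (d x.1) δ N} = ⋃ k ∈ Finset.range N,
      {x : G × Plane | ‖x.2 - (p x.1 + (((2 * k + 1 : ℝ) / (2 * N))) • d x.1)‖ ≤ 2 * δ} := by
    ext x
    simp only [tubeCover, Set.mem_iUnion, mem_closedBall_iff_norm, Set.mem_ofPred_eq]
  rw [h]
  refine Finset.measurableSet_biUnion _ fun k _ => ?_
  obtain ⟨c, hc⟩ : ∃ c : ℝ, c = (2 * k + 1) / (2 * N) := ⟨_, rfl⟩
  rw [← hc]
  have h2 : Measurable fun x : G × Plane => x.2 - (p x.1 + c • d x.1) :=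
    measurable_snd.sub (hp'.add (hd'.const_smul c))
  exact measurableSet_le h2.norm measurable_const

/-- Within time `t`, a robot can only reach a set of area at most `V`, which depends measurably on
its configuration at the start. -/
def RobotModel.ReachBound {G U : Type} [NormedAddCommGroup G] [NormedSpace ℝ G]
    [MeasurableSpace G] [MeasurableSpace U] (R : RobotModel G U) (t V : ℝ) : Prop :=
  ∃ C : Set (G × Plane), MeasurableSet C ∧
    (∀ g, volume (Prod.mk g ⁻¹' C) ≤ ENNReal.ofReal V) ∧
    ∀ u g, R.IsTrajectory u g → ∀ a b, 0 ≤ a → a ≤ b → b ≤ a + t → (g a, R.position (g b)) ∈ C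

theorem RobotModel.reachBound_of_tube {G U : Type} [NormedAddCommGroup G] [NormedSpace ℝ G]
    [MeasurableSpace G] [MeasurableSpace U] {R : RobotModel G U} {p d : G → Plane}
    (hp : Measurable p) (hd : Measurable d) {t L δ : ℝ} (hL : 0 < L) (hδ : 0 < δ)
    (h : ∀ u g, R.IsTrajectory u g → ∀ a b, 0 ≤ a → a ≤ b → b ≤ a + t → ‖d (g a)‖ ≤ L ∧
      ∃ x : ℝ, 0 ≤ x ∧ x ≤ 1 ∧ ‖R.position (g b) - (p (g a) + x • d (g a))‖ ≤ δ) :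
    R.ReachBound t (2 * Real.pi * δ * L + 4 * Real.pi * δ ^ 2) := by
  obtain ⟨N, hN⟩ : ∃ N, N = ⌈L / (2 * δ)⌉₊ := ⟨_, rfl⟩
  refine ⟨{x | x.2 ∈ tubeCover (p x.1) (d x.1) δ N},
    measurableSet_prod_tubeCover hp hd _ _, fun g => ?_, fun u g hg a b ha hab hbt => ?_⟩
  · change volume (tubeCover (p g) (d g) δ N) ≤ _
    rw [hN]
    exact volume_tubeCover_le _ _ hL hδ
  · obtain ⟨hdL, x, hx0, hx1, hx⟩ := h u g hg a b ha hab hbt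
    change R.position (g b) ∈ tubeCover (p (g a)) (d (g a)) δ N
    rw [hN]
    exact mem_tubeCover hL hδ hdL hx0 hx1 hx

/-! ### Displacement along a trajectory -/

theorem RobotModel.IsTrajectory.sub_eq {G U : Type} [NormedAddCommGroup G] [NormedSpace ℝ G]
    [MeasurableSpace U] {R : RobotModel G U} {u : ℝ → U} {g : ℝ → G} (h : R.IsTrajectory u g)
    {a b : ℝ} (ha : 0 ≤ a) (hab : a ≤ b) :
    IntervalIntegrable (fun s => R.vectorField (g s) (u s)) volume a b ∧
      g b - g a = ∫ s in a..b, R.vectorField (g s) (u s) := by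
  obtain ⟨-, -, ia, ea⟩ := h.2 a ha
  obtain ⟨-, -, ib, eb⟩ := h.2 b (ha.trans hab)
  refine ⟨ia.symm.trans ib, ?_⟩
  rw [eb, ea, add_sub_add_left_eq_sub, intervalIntegral.integral_interval_sub_left ib ia]

theorem IntervalIntegrable.fst_snd_integral {E F : Type} [NormedAddCommGroup E] [NormedSpace ℝ E]
    [CompleteSpace E] [NormedAddCommGroup F] [NormedSpace ℝ F] [CompleteSpace F]
    {f : ℝ → E × F} {a b : ℝ} (hf : IntervalIntegrable f volume a b) :
    IntervalIntegrable (fun s => (f s).1) volume a b ∧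
    IntervalIntegrable (fun s => (f s).2) volume a b ∧
    (∫ s in a..b, f s).1 = ∫ s in a..b, (f s).1 ∧
    (∫ s in a..b, f s).2 = ∫ s in a..b, (f s).2 :=
  ⟨⟨hf.1.fst, hf.2.fst⟩, ⟨hf.1.snd, hf.2.snd⟩,
    ((ContinuousLinearMap.fst ℝ E F).intervalIntegral_comp_comm hf).symm,
    ((ContinuousLinearMap.snd ℝ E F).intervalIntegral_comp_comm hf).symm⟩

/-- A velocity error growing linearly in time integrates to the quadratic half-width of the tube. -/
theorem norm_integral_le_mul_sq_div_two {E : Type} [NormedAddCommGroup E] [NormedSpace ℝ E]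
    {f : ℝ → E} {a b t c : ℝ} (hc : 0 ≤ c) (hab : a ≤ b) (hbt : b ≤ a + t)
    (hf : ∀ s, a ≤ s → s ≤ b → ‖f s‖ ≤ c * (s - a)) :
    ‖∫ s in a..b, f s‖ ≤ c * t ^ 2 / 2 := by
  have h1 : ‖∫ s in a..b, f s‖ ≤ ∫ s in a..b, c * (s - a) :=
    intervalIntegral.norm_integral_le_of_norm_le hab
      (ae_of_all _ fun s hs => hf s hs.1.le hs.2) 
      ((by fun_prop : Continuous fun s : ℝ => c * (s - a)).intervalIntegrable _ _)
  have h2 : ∫ s in a..b, c * (s - a) = c * (b - a) ^ 2 / 2 := by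
    rw [intervalIntegral.integral_const_mul,
      intervalIntegral.integral_comp_sub_right (fun s => s) a, integral_id]
    ring
  rw [h2] at h1
  refine h1.trans ?_
  gcongr
  linarith

/-! #### Double integrator -/

theorem doubleIntegrator_norm_sub_le {vmax umax : ℝ} (humax : 0 ≤ umax)
    {u : ℝ → Plane} {g : ℝ → Plane × Plane}
    (h : (doubleIntegrator vmax umax).IsTrajectory u g) {a b t : ℝ} (ha : 0 ≤ a) (hab : a ≤ b)
    (hbt : b ≤ a + t) :
    ‖(g b).1 - ((g a).1 + (b - a) • (g a).2)‖ ≤ umax * t ^ 2 / 2 := by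
  have hv : ∀ s, a ≤ s → s ≤ b → ‖(g s).2 - (g a).2‖ ≤ umax * (s - a) := fun s hs _ => by
    obtain ⟨hi, he⟩ := h.sub_eq ha hs
    have := hi.fst_snd_integral.2.2.2
    rw [← he] at this
    rw [← Prod.snd_sub, this]
    refine (intervalIntegral.norm_integral_le_of_norm_le_const (C := umax) fun r hr => ?_).trans_eq
      (by rw [abs_of_nonneg (sub_nonneg.2 hs)])
    rw [Set.uIoc_of_le hs] at hr
    exact (h.2 r (ha.trans hr.1.le)).1
  obtain ⟨hi, he⟩ := h.sub_eq ha hab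
  obtain ⟨hi1, -, e1, -⟩ := hi.fst_snd_integral
  rw [← he] at e1
  have key : (g b).1 - ((g a).1 + (b - a) • (g a).2) = ∫ s in a..b, ((g s).2 - (g a).2) := by
    change IntervalIntegrable (fun s => (g s).2) volume a b at hi1
    rw [intervalIntegral.integral_sub hi1 intervalIntegrable_const,
      intervalIntegral.integral_const]
    rw [Prod.fst_sub] at e1
    change _ = ∫ s in a..b, (g s).2 at e1
    rw [← e1]
    abel
  rw [key]
  exact norm_integral_le_mul_sq_div_two humax hab hbt hv

theorem doubleIntegrator_reachBound {vmax umax t : ℝ} (hvmax : 0 < vmax) (humax : 0 < umax)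
    (ht : 0 < t) :
    (doubleIntegrator vmax umax).ReachBound t
      (Real.pi * umax * vmax * t ^ 3 + Real.pi * umax ^ 2 * t ^ 4) := by
  have hL : 0 < vmax * t := by positivity
  have hδ : 0 < umax * t ^ 2 / 2 := by positivity
  -- The segment is the free drift: `d = t • v`, and the parameter `(b - a) / t` picks the drifted
  -- position at time `b`.
  have key := RobotModel.reachBound_of_tube (R := doubleIntegrator vmax umax) (t := t)
    measurable_fst (measurable_snd.const_smul t) hL hδ fun u g h a b ha hab hbt => ⟨?_, (b - a) / t,
      div_nonneg (by linarith) ht.le, (div_le_one ht).2 (by linarith), ?_⟩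
  · convert key using 1
    ring
  · simp only [Pi.smul_apply]
    rw [norm_smul, Real.norm_of_nonneg ht.le, mul_comm]
    exact mul_le_mul_of_nonneg_right (h.2 a ha).2.1 ht.le
  · simp only [Pi.smul_apply]
    rw [smul_smul, div_mul_cancel₀ _ ht.ne']
    exact doubleIntegrator_norm_sub_le humax.le h ha hab hbt

/-! #### Differential drive -/

theorem norm_cos_sin (θ : ℝ) : ‖(!₂[Real.cos θ, Real.sin θ] : Plane)‖ = 1 := by
  simp [EuclideanSpace.norm_eq]

theorem norm_cos_sin_sub_le (θ φ : ℝ) :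
    ‖(!₂[Real.cos θ, Real.sin θ] : Plane) - !₂[Real.cos φ, Real.sin φ]‖ ≤ |θ - φ| := by
  rw [EuclideanSpace.norm_eq, Real.sqrt_le_left (abs_nonneg _)]
  simp only [PiLp.sub_apply, Fin.sum_univ_two, Real.norm_eq_abs, sq_abs]
  simp only [Matrix.cons_val_zero, Matrix.cons_val_one]
  -- The squared chord is `2 - 2 cos (θ - φ)`.
  have h1 := Real.one_sub_sq_div_two_le_cos (x := θ - φ)
  rw [Real.cos_sub] at h1
  nlinarith [Real.sin_sq_add_cos_sq θ, Real.sin_sq_add_cos_sq φ]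

/-- Freezing the heading at its initial value gives the displacement `y`, the signed distance
driven. The heading error is at most `wmax / ρ * (s - a)`, and the speed is at most `wmax`. -/
theorem differentialDrive_exists_norm_sub_le {ρ wmax : ℝ} (hρ : 0 < ρ) (hwmax : 0 < wmax)
    {u : ℝ → ℝ × ℝ} {g : ℝ → Plane × ℝ}
    (h : (differentialDrive ρ wmax).IsTrajectory u g) {a b t : ℝ} (ha : 0 ≤ a) (hab : a ≤ b)
    (hbt : b ≤ a + t) :
    ∃ y : ℝ, |y| ≤ wmax * t ∧
      ‖(g b).1 - ((g a).1 + y • !₂[Real.cos (g a).2, Real.sin (g a).2])‖ ≤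
        wmax ^ 2 * t ^ 2 / (2 * ρ) := by
  have hw : ∀ s, a ≤ s → |(1 / 2) * ((u s).1 + (u s).2)| ≤ wmax := fun s hs => by
    obtain ⟨h1, h2⟩ := (h.2 s (ha.trans hs)).1
    rw [abs_le] at *
    constructor <;> linarith
  have hθ : ∀ s, a ≤ s → |(g s).2 - (g a).2| ≤ wmax / ρ * (s - a) := fun s hs => by
    obtain ⟨hi, he⟩ := h.sub_eq ha hs
    have := hi.fst_snd_integral.2.2.2
    rw [← he] at this
    rw [← Prod.snd_sub, this, ← Real.norm_eq_abs]
    refine (intervalIntegral.norm_integral_le_of_norm_le_const (C := wmax / ρ)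
      fun r hr => ?_).trans_eq (by rw [abs_of_nonneg (sub_nonneg.2 hs)])
    rw [Set.uIoc_of_le hs] at hr
    obtain ⟨h1, h2⟩ := (h.2 r (ha.trans hr.1.le)).1
    change ‖(1 / (2 * ρ)) * ((u r).2 - (u r).1)‖ ≤ _
    rw [Real.norm_eq_abs, abs_mul, abs_of_pos (by positivity : 0 < 1 / (2 * ρ)), div_mul_eq_mul_div,
      div_le_div_iff₀ (by positivity) hρ]
    have : |(u r).2 - (u r).1| ≤ 2 * wmax := by
      rw [abs_le] at *
      constructor <;> linarith
    nlinarith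
  obtain ⟨hi, he⟩ := h.sub_eq ha hab
  obtain ⟨hi1, -, e1, -⟩ := hi.fst_snd_integral
  rw [← he, Prod.fst_sub] at e1
  change IntervalIntegrable (fun s => ((1 / 2) * ((u s).1 + (u s).2)) •
    (!₂[Real.cos (g s).2, Real.sin (g s).2] : Plane)) volume a b at hi1
  change _ = ∫ s in a..b, ((1 / 2) * ((u s).1 + (u s).2)) •
    (!₂[Real.cos (g s).2, Real.sin (g s).2] : Plane) at e1
  -- A trajectory only supplies integrability of speed times direction; that of the speed alone
  -- follows from the measurable, bounded input.
  have hm : Measurable fun s => (1 / 2) * ((u s).1 + (u s).2) := by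
    have := h.1
    fun_prop
  have hint : IntervalIntegrable (fun s => (1 / 2) * ((u s).1 + (u s).2)) volume a b := by
    rw [intervalIntegrable_iff, Set.uIoc_of_le hab]
    refine Measure.integrableOn_of_bounded (M := wmax) measure_Ioc_lt_top.ne
      hm.aestronglyMeasurable ?_
    rw [ae_restrict_iff' measurableSet_Ioc]
    exact ae_of_all _ fun s hs => hw s hs.1.le
  refine ⟨∫ s in a..b, (1 / 2) * ((u s).1 + (u s).2), ?_, ?_⟩
  · rw [← Real.norm_eq_abs]
    refine (intervalIntegral.norm_integral_le_of_norm_le_const (C := wmax) fun s hs => ?_).trans ?_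
    · rw [Set.uIoc_of_le hab] at hs
      exact hw s hs.1.le
    · rw [abs_of_nonneg (sub_nonneg.2 hab)]
      gcongr
      linarith
  · have key : (g b).1 - ((g a).1 + (∫ s in a..b, (1 / 2) * ((u s).1 + (u s).2)) •
        !₂[Real.cos (g a).2, Real.sin (g a).2]) =
        ∫ s in a..b, ((1 / 2) * ((u s).1 + (u s).2)) •
          ((!₂[Real.cos (g s).2, Real.sin (g s).2] : Plane) -
            !₂[Real.cos (g a).2, Real.sin (g a).2]) := by
      simp only [smul_sub]
      rw [← sub_sub, e1, intervalIntegral.integral_sub hi1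
        ⟨hint.1.smul_const _, hint.2.smul_const _⟩, intervalIntegral.integral_smul_const]
    rw [key]
    refine (norm_integral_le_mul_sq_div_two (c := wmax ^ 2 / ρ) (by positivity) hab hbt
      fun s hs _ => ?_).trans_eq (by field_simp)
    rw [norm_smul, Real.norm_eq_abs]
    calc _ ≤ wmax * (wmax / ρ * (s - a)) :=
          mul_le_mul (hw s hs) ((norm_cos_sin_sub_le _ _).trans (hθ s hs)) (norm_nonneg _) hwmax.le
      _ = _ := by ring

theorem differentialDrive_reachBound {ρ wmax t : ℝ} (hρ : 0 < ρ) (hwmax : 0 < wmax)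
    (ht : 0 < t) :
    (differentialDrive ρ wmax).ReachBound t
      (2 * Real.pi * wmax ^ 3 / ρ * t ^ 3 + Real.pi * wmax ^ 4 / ρ ^ 2 * t ^ 4) := by
  have hL : 0 < 2 * (wmax * t) := by positivity
  have hδ : 0 < wmax ^ 2 * t ^ 2 / (2 * ρ) := by positivity
  have he : Measurable fun g : Plane × ℝ => (!₂[Real.cos g.2, Real.sin g.2] : Plane) := by
    fun_prop
  -- The robot can also reverse, so the segment extends `wmax * t` both ways from the start, and `y`
  -- is rescaled to `[0, 1]`.
  have key := RobotModel.reachBound_of_tube (R := differentialDrive ρ wmax) (t := t)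
    (measurable_fst.sub (he.const_smul (wmax * t))) (he.const_smul (2 * (wmax * t))) hL hδ
    fun u g h a b ha hab hbt => ?_
  · convert key using 1
    field_simp
    ring
  · obtain ⟨y, hy, hyb⟩ := differentialDrive_exists_norm_sub_le hρ hwmax h ha hab hbt
    rw [abs_le] at hy
    refine ⟨?_, (y + wmax * t) / (2 * (wmax * t)), div_nonneg (by linarith) hL.le,
      (div_le_one hL).2 (by linarith), ?_⟩
    · simp only [Pi.smul_apply]
      rw [norm_smul, norm_cos_sin, mul_one, Real.norm_of_nonneg hL.le]
    · simp only [Pi.smul_apply, Pi.sub_apply]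
      rw [smul_smul, div_mul_cancel₀ _ hL.ne']
      convert hyb using 2
      change (g b).1 - _ = _
      module
/-! ### The law of the requests -/

theorem MeasureTheory.measure_prod_le_of_section_le {α β : Type*} [MeasurableSpace α]
    [MeasurableSpace β] (μ : Measure α) [IsProbabilityMeasure μ] (ν : Measure β) [SFinite ν]
    {s : Set (α × β)} (hs : MeasurableSet s) {c : ℝ≥0∞} (h : ∀ x, ν (Prod.mk x ⁻¹' s) ≤ c) :
    (μ.prod ν) s ≤ c := by
  rw [Measure.prod_apply hs]
  exact (lintegral_mono h).trans_eq (by simp)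

/-- Resampling one coordinate preserves an infinite product of probability measures. -/
theorem MeasureTheory.measurePreserving_update_infinitePi {ι : Type*} [DecidableEq ι]
    {X : ι → Type*} [∀ i, MeasurableSpace (X i)] (μ : ∀ i, Measure (X i))
    [∀ i, IsProbabilityMeasure (μ i)] (j : ι) :
    MeasurePreserving (fun x : (∀ i, X i) × X j => Function.update x.1 j x.2)
      ((Measure.infinitePi μ).prod (μ j)) (Measure.infinitePi μ) := by
  have hm : Measurable fun x : (∀ i, X i) × X j => Function.update x.1 j x.2 := by
    refine measurable_pi_lambda _ fun i => ?_
    by_cases h : i = j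
    · subst h
      simpa using measurable_snd
    · simp only [Function.update_of_ne h]
      exact (measurable_pi_apply i).comp measurable_fst
  refine ⟨hm, Measure.eq_infinitePi μ fun s t ht => ?_⟩
  rw [Measure.map_apply hm (MeasurableSet.pi s.countable_toSet fun i _ => ht i)]
  by_cases hj : j ∈ s
  · have : (fun x : (∀ i, X i) × X j => Function.update x.1 j x.2) ⁻¹' (s : Set ι).pi t =
        ((s.erase j : Finset ι) : Set ι).pi t ×ˢ t j := by
      ext x
      simp only [Set.mem_preimage, Set.mem_pi, Finset.mem_coe, Set.mem_prod, Finset.mem_erase]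
      constructor
      · refine fun h => ⟨fun i hi => ?_, by simpa using h j hj⟩
        simpa [Function.update_of_ne hi.1] using h i hi.2
      · rintro ⟨h1, h2⟩ i hi
        by_cases h : i = j
        · subst h
          simpa using h2
        · simpa [Function.update_of_ne h] using h1 i ⟨h, hi⟩
    rw [this, Measure.prod_prod, Measure.infinitePi_pi _ fun i _ => ht i,
      Finset.prod_erase_mul _ _ hj]
  · have : (fun x : (∀ i, X i) × X j => Function.update x.1 j x.2) ⁻¹' (s : Set ι).pi t =
        (s : Set ι).pi t ×ˢ Set.univ := by
      ext x
      simp only [Set.mem_preimage, Set.mem_pi, Finset.mem_coe, Set.mem_prod, Set.mem_univ, and_true]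
      refine forall₂_congr fun i hi => ?_
      rw [Function.update_of_ne (ne_of_mem_of_not_mem (Finset.mem_coe.1 hi) hj)]
    rw [this, Measure.prod_prod, Measure.infinitePi_pi _ fun i _ => ht i, measure_univ, mul_one]

theorem ProbabilityTheory.ae_pos_expMeasure {lam : ℝ} : ∀ᵐ x ∂expMeasure lam, 0 < x := by
  have h : (expMeasure lam) (Set.Iic 0) = 0 := by
    rw [expMeasure, gammaMeasure, withDensity_apply _ measurableSet_Iic,
      ← setLIntegral_congr Iio_ae_eq_Iic]
    exact lintegral_gammaPDF_of_nonpos le_rfl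
  rw [ae_iff]
  simpa [Set.Iic, not_lt] using h

theorem isProbabilityMeasure_requestFactor {Q : Set Plane} {lam : ℝ} (hlam : 0 < lam)
    (h0 : volume Q ≠ 0) (htop : volume Q ≠ ∞) :
    IsProbabilityMeasure ((expMeasure lam).prod (cond volume Q)) := by
  have := isProbabilityMeasure_expMeasure hlam
  have := cond_isProbabilityMeasure_of_finite h0 htop
  infer_instance

theorem ae_isSimpleStream {Q : Set Plane} {lam : ℝ} (hlam : 0 < lam)
    (h0 : volume Q ≠ 0) (htop : volume Q ≠ ∞) :
    ∀ᵐ r ∂requestLaw Q lam, IsSimpleStream r := by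
  have := isProbabilityMeasure_requestFactor hlam h0 htop
  have := isProbabilityMeasure_expMeasure hlam
  have := cond_isProbabilityMeasure_of_finite h0 htop
  refine ae_all_iff.2 fun k => ?_
  have h1 : ∀ᵐ x ∂(expMeasure lam).prod (cond volume Q), 0 < x.1 :=
    Measure.quasiMeasurePreserving_fst.ae ae_pos_expMeasure
  exact (measurePreserving_eval_infinitePi
    (fun _ : ℕ => (expMeasure lam).prod (cond volume Q)) k).quasiMeasurePreserving.ae h1

/-! ### Causality -/

theorem IsSimpleStream.arrivalTime_pos {r : RequestStream} (h : IsSimpleStream r) (j : ℕ) :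
    0 < arrivalTime r j :=
  Finset.sum_pos (fun k _ => h k) ⟨0, by simp⟩

theorem arrivalTime_update (r : RequestStream) (j k : ℕ) (q : Plane) :
    arrivalTime (Function.update r j ((r j).1, q)) k = arrivalTime r k := by
  refine Finset.sum_congr rfl fun i _ => ?_
  by_cases h : i = j
  · subst h; simp
  · rw [Function.update_of_ne h]

theorem IsSimpleStream.update {r : RequestStream} (h : IsSimpleStream r) (j : ℕ) (q : Plane) :
    IsSimpleStream (Function.update r j ((r j).1, q)) := fun k => by
  by_cases hk : k = j
  · subst hk; simpa using h k
  · rw [Function.update_of_ne hk]; exact h k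

theorem sameHistory_update {r : RequestStream} {j : ℕ} {t : ℝ} (ht : t < arrivalTime r j) (q : Plane) :
    SameHistory r (Function.update r j ((r j).1, q)) t := fun k hk => by
  rw [arrivalTime_update, or_self] at hk
  have hkj : k ≠ j := fun e => absurd (e ▸ hk) (not_le.2 ht)
  rw [arrivalTime_update, Function.update_of_ne hkj]
  exact ⟨rfl, rfl⟩

theorem measurable_arrivalTime (j : ℕ) : Measurable fun r : RequestStream => arrivalTime r j :=
  Finset.measurable_sum _ fun k _ => measurable_fst.comp (measurable_pi_apply k)

/-- The last multiple of `ε` that precedes the positive time `τ`, as a multiple. -/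
noncomputable def lastTick (ε τ : ℝ) : ℕ := ⌈τ / ε⌉₊ - 1

/-- Strictness is why `lastTick` uses a ceiling minus one and not a floor: even if `τ` is itself a
multiple of `ε`, the request arriving at `τ` is not yet visible at the tick. -/
theorem lastTick_mul_lt {ε τ : ℝ} (hε : 0 < ε) (hτ : 0 < τ) : lastTick ε τ * ε < τ := by
  have h1 : 0 < ⌈τ / ε⌉₊ := Nat.ceil_pos.2 (by positivity)
  rw [← lt_div_iff₀ hε, ← Nat.lt_ceil, lastTick]
  omega

theorem le_lastTick_mul_add {ε τ : ℝ} (hε : 0 < ε) : τ ≤ lastTick ε τ * ε + ε := by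
  have h : ⌈τ / ε⌉₊ ≤ lastTick ε τ + 1 := by rw [lastTick]; omega
  have h2 : τ / ε ≤ (lastTick ε τ + 1 : ℕ) := Nat.ceil_le.1 h
  rw [div_le_iff₀ hε] at h2
  push_cast at h2
  linarith

theorem measurable_lastTick (ε : ℝ) : Measurable (lastTick ε) :=
  (measurable_from_top (f := fun n : ℕ => n - 1)).comp
    (Nat.measurable_ceil.comp (measurable_id.div_const ε))

/-! ### Independence of a request from earlier configurations, and the expected wait -/

namespace Policy

variable {G U : Type} [NormedAddCommGroup G] [NormedSpace ℝ G] [MeasurableSpace G]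
  [MeasurableSpace U] {R : RobotModel G U} {m : ℕ}

/-- The configuration of robot `i` at the last multiple of `ε` before the generation of
request `j`. -/
noncomputable def configBefore (π : Policy R m) (ε : ℝ) (j : ℕ) (i : Fin m)
    (ω : I × RequestStream) : G :=
  π.config ω.1 ω.2 i (lastTick ε (arrivalTime ω.2 j) * ε)

/-- Policies are assumed measurable only at fixed times. Ticks take countably many values, so
measurability at this random time follows. -/
theorem measurable_configBefore (π : Policy R m) {ε : ℝ} (hε : 0 < ε) (j : ℕ) (i : Fin m) :
    Measurable (π.configBefore ε j i) := by
  have h1 : Measurable fun x : (I × RequestStream) × ℕ => π.config x.1.1 x.1.2 i (x.2 * ε) :=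
    measurable_from_prod_countable_left fun n => π.measurable_config i (n * ε) (by positivity)
  exact h1.comp (measurable_id.prodMk
    ((measurable_lastTick ε).comp ((measurable_arrivalTime j).comp measurable_snd)))

theorem configBefore_update (π : Policy R m) {ε : ℝ} (hε : 0 < ε) (j : ℕ) (i : Fin m) (z : I)
    {r : RequestStream} (hr : IsSimpleStream r) (q : Plane) :
    π.configBefore ε j i (z, Function.update r j ((r j).1, q)) = π.configBefore ε j i (z, r) := by
  simp only [configBefore, arrivalTime_update]
  exact (π.config_causal z _ _ _ hr (hr.update j q) (by positivity)
    (sameHistory_update (lastTick_mul_lt hε (hr.arrivalTime_pos j)) q) i).symm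

/-- The event that request `j` appears in the set which `C` assigns to the configuration of some
robot shortly before. -/
def caught (π : Policy R m) (C : Set (G × Plane)) (ε : ℝ) (j : ℕ) : Set (I × RequestStream) :=
  ⋃ i, {ω | (π.configBefore ε j i ω, (ω.2 j).2) ∈ C}

theorem measurableSet_caught (π : Policy R m) {C : Set (G × Plane)} (hC : MeasurableSet C) {ε : ℝ}
    (hε : 0 < ε) (j : ℕ) : MeasurableSet (π.caught C ε j) :=
  MeasurableSet.iUnion fun i => ((π.measurable_configBefore hε j i).prodMk
    (measurable_snd.comp ((measurable_pi_apply j).comp measurable_snd))) hC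

theorem measure_configBefore_le (π : Policy R m) {Q : Set Plane} (hQ : MeasurableSet Q)
    (h0 : volume Q ≠ 0) (htop : volume Q ≠ ∞) {lam : ℝ} (hlam : 0 < lam)
    {C : Set (G × Plane)} (hC : MeasurableSet C) {V : ℝ≥0∞}
    (hV : ∀ g, volume (Prod.mk g ⁻¹' C) ≤ V) {ε : ℝ} (hε : 0 < ε) (j : ℕ) (i : Fin m) :
    ((volume : Measure I).prod (requestLaw Q lam))
      {ω | (π.configBefore ε j i ω, (ω.2 j).2) ∈ C} ≤ (volume Q)⁻¹ * V := by
  have := isProbabilityMeasure_requestFactor hlam h0 htop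
  have := isProbabilityMeasure_expMeasure hlam
  have := cond_isProbabilityMeasure_of_finite h0 htop
  set μ : Measure (ℝ × Plane) := (expMeasure lam).prod (cond volume Q) with hμ
  set P : Measure RequestStream := Measure.infinitePi fun _ : ℕ => μ with hP
  have hS : MeasurableSet {ω : I × RequestStream | (π.configBefore ε j i ω, (ω.2 j).2) ∈ C} :=
    ((π.measurable_configBefore hε j i).prodMk
      (measurable_snd.comp ((measurable_pi_apply j).comp measurable_snd))) hC
  have hup := MeasureTheory.measurePreserving_update_infinitePi (fun _ : ℕ => μ) j
  -- Request `j` is resampled, which makes its location a separate coordinate.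
  have hmp : MeasurePreserving (fun x : I × RequestStream × ℝ × Plane =>
      (x.1, Function.update x.2.1 j x.2.2))
      ((volume : Measure I).prod (P.prod μ)) ((volume : Measure I).prod P) :=
    (MeasurePreserving.id _).prod hup
  have hmp0 : Measurable (fun x : I × RequestStream × ℝ × Plane =>
      (x.1, Function.update x.2.1 j (x.2.2.1, (0 : Plane)))) :=
    hmp.measurable.comp (by fun_prop : Measurable fun x : I × RequestStream × ℝ × Plane =>
      (x.1, x.2.1, (x.2.2.1, (0 : Plane))))
  change ((volume : Measure I).prod P) _ ≤ _
  rw [← hmp.measure_preimage hS.nullMeasurableSet]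
  have hae : ∀ᵐ x ∂(volume : Measure I).prod (P.prod μ),
      IsSimpleStream (Function.update x.2.1 j x.2.2) := by
    have h1 : ∀ᵐ ω ∂(volume : Measure I).prod P, IsSimpleStream ω.2 :=
      Measure.quasiMeasurePreserving_snd.ae (ae_isSimpleStream hlam h0 htop)
    exact hmp.quasiMeasurePreserving.ae h1
  -- Location `j` is replaced by `0` inside the configuration, which cannot depend on it. Causality
  -- is assumed only for simple streams, so the event lies in `S'` only almost surely; but every
  -- section of `S'` with seed, stream and gap fixed is a section of `C`.
  set S' : Set (I × RequestStream × ℝ × Plane) := {x |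
    (π.configBefore ε j i (x.1, Function.update x.2.1 j (x.2.2.1, 0)), x.2.2.2) ∈ C} with hS'
  have hS'm : MeasurableSet S' :=
    (((π.measurable_configBefore hε j i).comp hmp0).prodMk (by fun_prop)) hC
  refine (measure_mono_ae (t := S') ?_).trans ?_
  · filter_upwards [hae] with x hx hxS
    have h2 := π.configBefore_update hε j i x.1 hx 0
    simp only [Function.update_self, Function.update_idem] at h2
    change (_, _) ∈ C at hxS
    change (_, _) ∈ C
    rw [h2]
    simpa using hxS
  · refine measure_prod_le_of_section_le _ _ hS'm fun z => ?_
    have m1 := measurable_prodMk_left (x := z) hS'm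
    refine measure_prod_le_of_section_le _ _ m1 fun r => ?_
    have m2 := measurable_prodMk_left (x := r) m1
    refine measure_prod_le_of_section_le _ _ m2 fun y => ?_
    rw [cond_apply hQ]
    gcongr
    exact (measure_mono Set.inter_subset_right).trans
      (hV (π.configBefore ε j i (z, Function.update r j (y, 0))))

theorem measure_caught_le (π : Policy R m) {Q : Set Plane} (hQ : MeasurableSet Q)
    (h0 : volume Q ≠ 0) (htop : volume Q ≠ ∞) {lam : ℝ} (hlam : 0 < lam)
    {C : Set (G × Plane)} (hC : MeasurableSet C) {V : ℝ≥0∞}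
    (hV : ∀ g, volume (Prod.mk g ⁻¹' C) ≤ V) {ε : ℝ} (hε : 0 < ε) (j : ℕ) :
    ((volume : Measure I).prod (requestLaw Q lam)) (π.caught C ε j) ≤
      m * ((volume Q)⁻¹ * V) := by
  refine (measure_iUnion_fintype_le _ _).trans ((Finset.sum_le_sum fun i _ =>
    π.measure_configBefore_le hQ h0 htop hlam hC hV hε j i).trans_eq ?_)
  simp

/-- The tick lies at most `t - s` before the arrival, so service in less than `s` would be a motion
of duration at most `t` from the configuration at the tick. -/
theorem le_waitingTime_of_not_caught (π : Policy R m) {C : Set (G × Plane)} {s t : ℝ} (hst : s < t)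
    (hC : ∀ u g, R.IsTrajectory u g → ∀ a b, 0 ≤ a → a ≤ b → b ≤ a + t →
      (g a, R.position (g b)) ∈ C)
    (j : ℕ) (z : I) {r : RequestStream} (hr : IsSimpleStream r)
    (h : (z, r) ∉ π.caught C (t - s) j) : ENNReal.ofReal s ≤ π.waitingTime j z r := by
  have hε : 0 < t - s := sub_pos.2 hst
  refine le_iInf₂ fun s' ⟨hs', i, hi⟩ => ENNReal.ofReal_le_ofReal ?_
  by_contra! hlt
  refine h (Set.mem_iUnion.2 ⟨i, ?_⟩)
  change (π.config z r i _, (r j).2) ∈ C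
  rw [← hi]
  have h1 := lastTick_mul_lt hε (hr.arrivalTime_pos j)
  have h2 := le_lastTick_mul_add (τ := arrivalTime r j) hε
  exact hC _ _ (π.isTrajectory z r hr i) _ _ (by positivity) (by linarith) (by linarith)

/-- This is Markov's inequality. Bounding below by a measurable indicator avoids any measurability
of `waitingTime`. -/
theorem le_expectedWaitingTime (π : Policy R m) {Q : Set Plane} (hQ : MeasurableSet Q)
    (h0 : volume Q ≠ 0) (htop : volume Q ≠ ∞) {lam : ℝ} (hlam : 0 < lam) {s t V : ℝ}
    (hs : 0 ≤ s) (hst : s < t) (hV : 0 ≤ V) (hR : R.ReachBound t V) (j : ℕ) :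
    ENNReal.ofReal (s * (1 - m * V / volume.real Q)) ≤ π.expectedWaitingTime Q lam j := by
  obtain ⟨C, hC, hCV, hCR⟩ := hR
  have := isProbabilityMeasure_requestFactor hlam h0 htop
  have hε : 0 < t - s := sub_pos.2 hst
  have : IsProbabilityMeasure (requestLaw Q lam) := by unfold requestLaw; infer_instance
  have hB := π.measurableSet_caught hC hε j
  have hA : 0 < volume.real Q := ENNReal.toReal_pos h0 htop
  have hPB := π.measure_caught_le hQ h0 htop hlam hC hCV hε j
  have hr : (m * ((volume Q)⁻¹ * ENNReal.ofReal V) : ℝ≥0∞) =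
      ENNReal.ofReal (m * V / volume.real Q) := by
    rw [ENNReal.ofReal_div_of_pos hA, ENNReal.ofReal_mul (by positivity), ENNReal.ofReal_natCast,
      measureReal_def, ENNReal.ofReal_toReal htop, div_eq_mul_inv, mul_assoc, mul_comm (_)⁻¹]
  rw [hr] at hPB
  calc ENNReal.ofReal (s * (1 - m * V / volume.real Q))
      = ENNReal.ofReal s * (1 - ENNReal.ofReal (m * V / volume.real Q)) := by
        rw [ENNReal.ofReal_mul hs, ENNReal.ofReal_sub _ (by positivity), ENNReal.ofReal_one]
    _ ≤ ENNReal.ofReal s *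
          ((volume : Measure I).prod (requestLaw Q lam)) (π.caught C (t - s) j)ᶜ := by
        rw [prob_compl_eq_one_sub hB]
        gcongr
    _ = ∫⁻ ω, (π.caught C (t - s) j)ᶜ.indicator (fun _ => ENNReal.ofReal s) ω
          ∂(volume : Measure I).prod (requestLaw Q lam) :=
        (lintegral_indicator_const hB.compl _).symm
    _ ≤ π.expectedWaitingTime Q lam j := by
        have h1 : ∀ᵐ ω ∂(volume : Measure I).prod (requestLaw Q lam), IsSimpleStream ω.2 :=
          Measure.quasiMeasurePreserving_snd.ae (ae_isSimpleStream hlam h0 htop)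
        refine lintegral_mono_ae ?_
        filter_upwards [h1] with ω hω
        by_cases h : ω ∈ π.caught C (t - s) j
        · simp [h]
        · rw [Set.indicator_of_mem h]
          exact π.le_waitingTime_of_not_caught hst hCR j ω.1 hω h

end Policy

theorem le_optimalCost {G U : Type} [NormedAddCommGroup G] [NormedSpace ℝ G]
    [MeasurableSpace G] [MeasurableSpace U] {R : RobotModel G U} {Q : Set Plane}
    (hQ : MeasurableSet Q) (h0 : volume Q ≠ 0) (htop : volume Q ≠ ∞) {s t V : ℝ}
    (hs : 0 ≤ s) (hst : s < t) (hV : 0 ≤ V) (hR : R.ReachBound t V) (m : ℕ) :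
    ENNReal.ofReal (s * (1 - m * V / volume.real Q)) ≤ optimalCost R Q m := by
  refine le_iInf fun π => le_liminf_of_le (by isBoundedDefault) (Eventually.of_forall fun j =>
    le_liminf_of_le (by isBoundedDefault) ?_)
  filter_upwards [self_mem_nhdsWithin] with lam hlam
  exact π.le_expectedWaitingTime hQ h0 htop hlam hs hst hV hR j

/-! ### Many robots -/

theorem rpow_one_third_pow_three {x : ℝ} (hx : 0 ≤ x) : (x ^ (1 / 3 : ℝ)) ^ 3 = x := by
  rw [← Real.rpow_natCast, ← Real.rpow_mul hx]
  norm_num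

/-- The choice `t = κ m^(-1/3)` makes `m α t³ / A = 1/4`, which maximises `t (1 - m α t³ / A)`. The
`β` term is eventually at most 1/100, so a request escapes with probability at least 0.74. With `s =
19/20 t` the factor is 0.703 > 7/10, and `343 / 1000` is the cube of 7/10. -/
theorem eventually_le_optimalCost {G U : Type} [NormedAddCommGroup G] [NormedSpace ℝ G]
    [MeasurableSpace G] [MeasurableSpace U] {R : RobotModel G U} {Q : Set Plane}
    (hQ : MeasurableSet Q) (h0 : volume Q ≠ 0) (htop : volume Q ≠ ∞) {α β : ℝ}
    (hα : 0 < α) (hβ : 0 ≤ β) (hR : ∀ t, 0 < t → R.ReachBound t (α * t ^ 3 + β * t ^ 4))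
    {c : ℝ} (hcα : 4 * α * c ^ 3 ≤ 343 / 1000 * volume.real Q) :
    ∀ᶠ m : ℕ in atTop, ENNReal.ofReal (c * (m : ℝ) ^ (-(1 / 3) : ℝ)) ≤ optimalCost R Q m := by
  set A := volume.real Q with hAdef
  have hA : 0 < A := ENNReal.toReal_pos h0 htop
  set κ := (A / (4 * α)) ^ (1 / 3 : ℝ) with hκ
  have hκ0 : 0 < κ := by positivity
  have hκ3 : κ ^ 3 = A / (4 * α) := rpow_one_third_pow_three (by positivity)
  have hcκ : c ≤ 7 / 10 * κ := by
    refine le_of_pow_le_pow_left₀ three_ne_zero (by positivity) ?_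
    rw [mul_pow, hκ3, mul_div_assoc', le_div_iff₀ (by positivity)]
    linarith
  have hlim : Tendsto (fun m : ℕ => β * κ / (4 * α) * (m : ℝ) ^ (-(1 / 3) : ℝ)) atTop (𝓝 0) := by
    have := (tendsto_rpow_neg_atTop (y := (1 / 3 : ℝ)) (by norm_num)).comp
      (tendsto_natCast_atTop_atTop (R := ℝ))
    simpa using this.const_mul (β * κ / (4 * α))
  filter_upwards [hlim.eventually_le_const (by norm_num : (0 : ℝ) < 1 / 100),
    eventually_gt_atTop 0] with m hm hm0
  have hm0' : (0 : ℝ) < m := by exact_mod_cast hm0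
  set x := (m : ℝ) ^ (-(1 / 3) : ℝ) with hx
  have hx0 : 0 < x := by positivity
  have hx3 : m * x ^ 3 = 1 := by
    rw [hx, ← Real.rpow_natCast, ← Real.rpow_mul hm0'.le]
    norm_num
    rw [Real.rpow_neg_one, mul_inv_cancel₀ hm0'.ne']
  have ht : 0 < κ * x := by positivity
  refine le_trans (ENNReal.ofReal_le_ofReal ?_) (le_optimalCost hQ h0 htop
    (s := 19 / 20 * (κ * x)) (t := κ * x) (by positivity) (by linarith) (by positivity)
    (hR _ ht) m)
  have hV : m * (α * (κ * x) ^ 3 + β * (κ * x) ^ 4) / A = 1 / 4 + β * κ / (4 * α) * x := by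
    have : m * (α * (κ * x) ^ 3 + β * (κ * x) ^ 4) =
        (m * x ^ 3) * (κ ^ 3 * (α + β * κ * x)) := by ring
    rw [this, hx3, hκ3]
    field_simp
  rw [hV]
  have h1 : 74 / 100 ≤ 1 - (1 / 4 + β * κ / (4 * α) * x) := by linarith
  calc c * x ≤ 7 / 10 * κ * x := by gcongr
    _ ≤ 19 / 20 * (κ * x) * (74 / 100) := by nlinarith
    _ ≤ _ := by gcongr

theorem ofReal_le_liminf_mul_rpow {f : ℕ → ℝ≥0∞} {c : ℝ} (hc : 0 ≤ c)
    (h : ∀ᶠ m : ℕ in atTop, ENNReal.ofReal (c * (m : ℝ) ^ (-(1 / 3) : ℝ)) ≤ f m) :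
    ENNReal.ofReal c ≤ liminf (fun m : ℕ => f m * (m : ℝ≥0∞) ^ (1 / 3 : ℝ)) atTop := by
  refine le_liminf_of_le (by isBoundedDefault) ?_
  filter_upwards [h, eventually_gt_atTop 0] with m hm hm0
  have hm0' : (0 : ℝ) < m := by exact_mod_cast hm0
  calc ENNReal.ofReal c
      = ENNReal.ofReal (c * (m : ℝ) ^ (-(1 / 3) : ℝ)) * (m : ℝ≥0∞) ^ (1 / 3 : ℝ) := by
        rw [← ENNReal.ofReal_natCast, ENNReal.ofReal_rpow_of_pos hm0',
          ← ENNReal.ofReal_mul (by positivity), mul_assoc, ← Real.rpow_add hm0']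
        norm_num
    _ ≤ _ := by gcongr

theorem mainTheorem1 (Q : Set Plane) (hQconvex : Convex ℝ Q) (hQcompact : IsCompact Q)
    (hQinterior : (interior Q).Nonempty)
    (vmax umax ρ wmax : ℝ) (hvmax : 0 < vmax) (humax : 0 < umax) (hρ : 0 < ρ) (hwmax : 0 < wmax) :
    ENNReal.ofReal ((1 / 24) * (volume.real Q / (2 * vmax * umax)) ^ (1 / 3 : ℝ)) ≤
        liminf (fun m : ℕ =>
          optimalCost (doubleIntegrator vmax umax) Q m * (m : ℝ≥0∞) ^ (1 / 3 : ℝ)) atTop ∧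
      ENNReal.ofReal ((1 / (5 * wmax)) * (6 * ρ * volume.real Q / 5) ^ (1 / 3 : ℝ)) ≤
        liminf (fun m : ℕ =>
          optimalCost (differentialDrive ρ wmax) Q m * (m : ℝ≥0∞) ^ (1 / 3 : ℝ)) atTop ∧
      (∃ c : ℝ, 0 < c ∧ ∀ᶠ m : ℕ in atTop,
        ENNReal.ofReal (c * (m : ℝ) ^ (-(1 / 3) : ℝ)) ≤
          optimalCost (doubleIntegrator vmax umax) Q m) ∧
      (∃ c : ℝ, 0 < c ∧ ∀ᶠ m : ℕ in atTop,
        ENNReal.ofReal (c * (m : ℝ) ^ (-(1 / 3) : ℝ)) ≤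
          optimalCost (differentialDrive ρ wmax) Q m) := by
  have h0 : volume Q ≠ 0 :=
    (Measure.measure_pos_of_nonempty_interior volume hQinterior).ne'
  have htop : volume Q ≠ ∞ := hQcompact.measure_lt_top.ne
  have hQ : MeasurableSet Q := hQcompact.measurableSet
  have hA : 0 < volume.real Q := ENNReal.toReal_pos h0 htop
  have hpi := Real.pi_lt_d2
  have hpi0 := Real.pi_pos
  have hDI0 : 0 < (1 / 24) * (volume.real Q / (2 * vmax * umax)) ^ (1 / 3 : ℝ) := by positivity
  have hDD0 : 0 < (1 / (5 * wmax)) * (6 * ρ * volume.real Q / 5) ^ (1 / 3 : ℝ) := by positivity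
  have hDI := eventually_le_optimalCost (R := doubleIntegrator vmax umax) hQ h0 htop
    (by positivity) (by positivity)
    (fun t ht => doubleIntegrator_reachBound hvmax humax ht)
    (c := (1 / 24) * (volume.real Q / (2 * vmax * umax)) ^ (1 / 3 : ℝ)) (by
      rw [mul_pow, rpow_one_third_pow_three (by positivity)]
      have : 4 * (Real.pi * umax * vmax) * ((1 / 24) ^ 3 * (volume.real Q / (2 * vmax * umax))) =
          Real.pi / 6912 * volume.real Q := by field_simp; norm_num
      rw [this]
      gcongr <;> linarith)
  have hDD := eventually_le_optimalCost (R := differentialDrive ρ wmax) hQ h0 htop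
    (by positivity) (by positivity)
    (fun t ht => differentialDrive_reachBound hρ hwmax ht)
    (c := (1 / (5 * wmax)) * (6 * ρ * volume.real Q / 5) ^ (1 / 3 : ℝ)) (by
      rw [mul_pow, rpow_one_third_pow_three (by positivity)]
      -- Here `π < 3.15` makes the factor `48 π / 625` less than 0.242, below the permitted 0.343;
      -- for the double integrator `π / 6912` is far below it.
      have : 4 * (2 * Real.pi * wmax ^ 3 / ρ) *
          ((1 / (5 * wmax)) ^ 3 * (6 * ρ * volume.real Q / 5)) =
          Real.pi * (48 / 625) * volume.real Q := by field_simp; norm_num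
      rw [this]
      gcongr
      linarith)
  exact ⟨ofReal_le_liminf_mul_rpow hDI0.le hDI, ofReal_le_liminf_mul_rpow hDD0.le hDD,
    ⟨_, hDI0, hDI⟩, ⟨_, hDD0, hDD⟩⟩
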